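/- Let $\Sigma$ be a closed connected orientable surface of genus $g\ge 2$. The vertices of the curve complex $C(\Sigma)$ are the isotopy classes of essential simple closed curves in $\Sigma$, and two distinct vertices span an edge if they have disjoint representatives; for two sets $A,B$ of vertices, $d(A,B)\in\{0,1,2,\dots,\infty\}$ denotes the least number of edges of a path in $C(\Sigma)$ from a vertex in $A$ to a vertex in $B$ (and $\infty$ if there is none). A pants decomposition $\mathcal P$ of $\Sigma$ is a collection of $3g-3$ pairwise disjoint essential simple closed curves such that every component of $\Sigma\setminus\bigcup\mathcal P$ is a pair of pants (a three-punctured sphere). Let $V_{\mathcal P}$ be the handlebody with boundary $\Sigma=\Sigma\times\{0\}$ obtained from $\Sigma\times[0,1]$ by attaching a 2-handle to $\Sigma\times\{1\}$ along each curve of $\mathcal P$ and then a 3-ball to each resulting boundary sphere, and let $K_{\mathcal P}$ be the set of isotopy classes of essential simple closed curves in $\Sigma$ that bound properly embedded disks in $V_{\mathcal P}$. Let $\mathcal P$ be a pants decomposition of $\Sigma$, let $\gamma$ be an essential simple closed curve in $\Sigma$, let $\tau_\gamma:\Sigma\to\Sigma$ be a Dehn twist about $\gamma$, and suppose that $d(K_{\mathcal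 P},\{[\gamma]\})=d$ for some integer $d\ge 1$. Then for every $k\in\mathbb Z$, $$d\bigl(K_{\mathcal P},K_{\tau_\gamma^k(\mathcal P)}\bigr)\le 2d-2 .$$ -/

import Mathlib

open Set Topology

/-! ### Simple closed curves, isotopy and the curve complex -/

/-- A simple closed curve in `S`, regarded as a subset: the image of an embedded circle. -/
def IsSimpleClosedCurve {S : Type*} [TopologicalSpace S] (c : Set S) : Prop :=
  ∃ f : C(Circle, S), IsEmbedding f ∧ range f = c

/-- An essential simple closed curve: one that is not homotopic to a point. -/
def IsEssentialCurve {S : Type*} [TopologicalSpace S] (c : Set S) : Prop :=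
  ∃ f : C(Circle, S), IsEmbedding f ∧ range f = c ∧ ¬ f.Nullhomotopic

/-- Two homeomorphisms of `S` are isotopic: they are joined by a path of homeomorphisms that is
jointly continuous in time and space. -/
def IsotopicHomeo {S : Type*} [TopologicalSpace S] (f g : S ≃ₜ S) : Prop :=
  ∃ H : unitInterval → (S ≃ₜ S),
    Continuous (fun p : unitInterval × S => H p.1 p.2) ∧ H 0 = f ∧ H 1 = g

/-- Two subsets of `S` are (ambient) isotopic: a homeomorphism of `S` that is isotopic to the
identity carries the one onto the other. -/
def IsotopicSets {S : Type*} [TopologicalSpace S] (c c' : Set S) : Prop :=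
  ∃ h : S ≃ₜ S, IsotopicHomeo (Homeomorph.refl S) h ∧ h '' c = c'

theorem IsotopicSets.refl {S : Type*} [TopologicalSpace S] (c : Set S) : IsotopicSets c c :=
  ⟨Homeomorph.refl S, ⟨fun _ => Homeomorph.refl S, by simpa using continuous_snd, rfl, rfl⟩,
    by simp⟩

theorem IsotopicSets.symm {S : Type*} [TopologicalSpace S] {c c' : Set S}
    (h : IsotopicSets c c') : IsotopicSets c' c := by
  obtain ⟨f, ⟨H, hc, h0, h1⟩, rfl⟩ := h
  refine ⟨f.symm, ⟨fun t => f.symm.trans (H (unitInterval.symm t)), ?_, ?_, ?_⟩, ?_⟩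
  · exact hc.comp (g := fun p : unitInterval × S => H p.1 p.2)
      (f := fun p : unitInterval × S => (unitInterval.symm p.1, f.symm p.2))
      (by fun_prop)
  · ext x; simp [h1]
  · ext x; simp [h0]
  · rw [← image_comp]; simp

theorem IsotopicSets.trans {S : Type*} [TopologicalSpace S] {c c' c'' : Set S}
    (h : IsotopicSets c c') (h' : IsotopicSets c' c'') : IsotopicSets c c'' := by
  obtain ⟨f, ⟨H, hc, h0, h1⟩, rfl⟩ := h
  obtain ⟨g, ⟨K, kc, k0, k1⟩, rfl⟩ := h'
  refine ⟨f.trans g, ⟨fun t => (H t).trans (K t), ?_, ?_, ?_⟩, ?_⟩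
  · exact kc.comp (g := fun p : unitInterval × S => K p.1 p.2)
      (f := fun p : unitInterval × S => (p.1, H p.1 p.2))
      (continuous_fst.prodMk hc)
  · ext x; simp [h0, k0]
  · ext x; simp [h1, k1]
  · rw [← image_comp]; rfl

/-- The essential simple closed curves of `S`. -/
def EssentialCurve (S : Type*) [TopologicalSpace S] : Type _ := {c : Set S // IsEssentialCurve c}

/-- Isotopy of essential simple closed curves. -/
instance curveSetoid (S : Type*) [TopologicalSpace S] : Setoid (EssentialCurve S) where
  r c c' := IsotopicSets c.1 c'.1
  iseqv := ⟨fun c => IsotopicSets.refl c.1, fun h => h.symm, fun h h' => h.trans h'⟩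

/-- The vertices of the curve complex: isotopy classes of essential simple closed curves. -/
def CurveVertex (S : Type*) [TopologicalSpace S] : Type _ := Quotient (curveSetoid S)

/-- The isotopy class of an essential simple closed curve. -/
def EssentialCurve.toVertex {S : Type*} [TopologicalSpace S] (c : EssentialCurve S) :
    CurveVertex S := Quotient.mk (curveSetoid S) c

/-- The 1-skeleton of the curve complex: two distinct isotopy classes span an edge if they have
disjoint representatives. -/
def curveGraph (S : Type*) [TopologicalSpace S] : SimpleGraph (CurveVertex S) where
  Adj v w := v ≠ w ∧ ∃ a b : EssentialCurve S,
    a.toVertex = v ∧ b.toVertex = w ∧ Disjoint a.1 b.1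
  symm := by
    constructor
    rintro v w ⟨hne, a, b, ha, hb, hd⟩
    exact ⟨hne.symm, b, a, hb, ha, hd.symm⟩
  loopless := ⟨fun _ h => h.1 rfl⟩

/-- The distance between two sets of vertices of the curve complex: the least number of edges of a
path from a vertex of the first to a vertex of the second (`⊤` if there is no such path). -/
noncomputable def curveDist {S : Type*} [TopologicalSpace S] (A B : Set (CurveVertex S)) : ℕ∞ :=
  ⨅ u ∈ A, ⨅ v ∈ B, (curveGraph S).edist u v

/-! ### Closed orientable surfaces -/

/-- A surface is orientable if it contains no Möbius band, i.e. there is no continuous map of the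
square that is injective up to exactly the identification `(0, t) ~ (1, 1 - t)`. -/
def IsOrientableSurface (S : Type*) [TopologicalSpace S] : Prop :=
  ¬ ∃ f : C(unitInterval × unitInterval, S), ∀ p q, f p = f q ↔
    p = q ∨ (p.1 = 0 ∧ q.1 = 1 ∧ q.2 = unitInterval.symm p.2) ∨
      (q.1 = 0 ∧ p.1 = 1 ∧ p.2 = unitInterval.symm q.2)

/-- The genus of a closed orientable surface: the largest number of pairwise disjoint simple closed
curves whose union does not disconnect the surface. -/
def HasGenus (S : Type*) [TopologicalSpace S] (g : ℕ) : Prop :=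
  IsGreatest {n : ℕ | ∃ c : Fin n → Set S, (∀ i, IsSimpleClosedCurve (c i)) ∧
    Pairwise (fun i j => Disjoint (c i) (c j)) ∧ IsConnected (⋃ i, c i)ᶜ} g

/-- The unit sphere in `ℝ³`. -/
abbrev UnitSphere : Type := Metric.sphere (0 : EuclideanSpace ℝ (Fin 3)) 1

/-- The closed unit ball in `ℝ³`. -/
abbrev UnitBall : Type := Metric.closedBall (0 : EuclideanSpace ℝ (Fin 3)) 1

/-- The closed unit disk. -/
abbrev UnitDisk : Type := Metric.closedBall (0 : ℂ) 1

/-- The boundary circle of the unit disk. -/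
def UnitDisk.circle : Set UnitDisk := {z | ‖(z : ℂ)‖ = 1}

/-- The inclusion of the circle as the boundary of the unit disk. -/
def UnitDisk.ofCircle (z : Circle) : UnitDisk :=
  ⟨z, mem_closedBall_zero_iff.2 z.norm_coe.le⟩

/-- The inclusion of the sphere as the boundary of the unit ball. -/
def UnitBall.ofSphere (x : UnitSphere) : UnitBall := ⟨x.1, Metric.sphere_subset_closedBall x.2⟩

/-- An `n`-punctured sphere. -/
def IsPuncturedSphere (n : ℕ) (X : Type*) [TopologicalSpace X] : Prop :=
  ∃ F : Finset UnitSphere, F.card = n ∧ Nonempty (X ≃ₜ {x : UnitSphere // x ∉ F})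

/-- A pants decomposition of a surface of genus `g`: a collection of `3g - 3` pairwise disjoint
essential simple closed curves such that each component of the complement of their union is a pair
of pants, i.e. a three-punctured sphere. -/
structure IsPantsDecomposition {S : Type*} [TopologicalSpace S] (g : ℕ)
    (P : Fin (3 * g - 3) → Set S) : Prop where
  essential : ∀ i, IsEssentialCurve (P i)
  disjoint : Pairwise (fun i j => Disjoint (P i) (P j))
  pants : ∀ x ∈ (⋃ i, P i)ᶜ, IsPuncturedSphere 3 (connectedComponentIn (⋃ i, P i)ᶜ x)

/-! ### Annular neighbourhoods and Dehn twists -/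

/-- The annulus `S¹ × [0, 1]`. -/
abbrev Annulus : Type := Circle × unitInterval

/-- The open annulus `S¹ × (0, 1)`. -/
def Annulus.interior : Set Annulus := {a | 0 < a.2 ∧ a.2 < 1}

/-- The core circle `S¹ × {1/2}` of the annulus. -/
def Annulus.core : Set Annulus := {a | (a.2 : ℝ) = 1 / 2}

/-- The twist map `(θ, t) ↦ (θ + 2πt, t)` of the annulus. -/
noncomputable def Annulus.twist : Annulus ≃ₜ Annulus where
  toFun a := (a.1 * Circle.exp (2 * Real.pi * (a.2 : ℝ)), a.2)
  invFun a := (a.1 * (Circle.exp (2 * Real.pi * (a.2 : ℝ)))⁻¹, a.2)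
  left_inv a := by simp
  right_inv a := by simp
  continuous_toFun := by fun_prop
  continuous_invFun := by fun_prop

theorem Annulus.twist_of_not_mem_interior {a : Annulus} (ha : a ∉ Annulus.interior) :
    Annulus.twist a = a := by
  obtain ⟨z, t⟩ := a
  have h : t = 0 ∨ t = 1 := by
    by_contra! h
    exact ha ⟨lt_of_le_of_ne t.2.1 fun e => h.1 e.symm, lt_of_le_of_ne t.2.2 fun e => h.2 e⟩
  rcases h with rfl | rfl <;> simp [Annulus.twist]

/-- A (parametrized) annular neighbourhood of a simple closed curve `c`: an embedded annulus with
core circle `c`. (In a surface the open annulus is automatically open, by invariance of domain.) -/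
structure AnnularNbhd {S : Type*} [TopologicalSpace S] (c : Set S) where
  φ : Annulus → S
  isEmbedding : IsEmbedding φ
  isOpen_interior : IsOpen (φ '' Annulus.interior)
  core : φ '' Annulus.core = c

namespace AnnularNbhd

variable {S : Type*} [TopologicalSpace S] {c : Set S} (N : AnnularNbhd c)

theorem extend_apply (e : Annulus ≃ₜ Annulus) (a : Annulus) :
    Function.extend N.φ (N.φ ∘ e) id (N.φ a) = N.φ (e a) :=
  N.isEmbedding.injective.extend_apply _ _ a

theorem extend_apply_of_not_mem (e : Annulus ≃ₜ Annulus)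
    (he : ∀ a, a ∉ Annulus.interior → e a = a) {x : S} (hx : x ∉ N.φ '' Annulus.interior) :
    Function.extend N.φ (N.φ ∘ e) id x = x := by
  by_cases h : ∃ a, N.φ a = x
  · obtain ⟨a, rfl⟩ := h
    rw [N.extend_apply, he a fun ha => hx ⟨a, ha, rfl⟩]
  · rw [Function.extend_apply' _ _ _ h, id]

theorem continuous_extend [T2Space S] (e : Annulus ≃ₜ Annulus)
    (he : ∀ a, a ∉ Annulus.interior → e a = a) :
    Continuous (Function.extend N.φ (N.φ ∘ e) id) := by
  have h1 : IsClosed (range N.φ) := (isCompact_range N.isEmbedding.continuous).isClosed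
  have h2 : IsClosed (N.φ '' Annulus.interior)ᶜ := N.isOpen_interior.isClosed_compl
  have hu : range N.φ ∪ (N.φ '' Annulus.interior)ᶜ = univ := by
    refine eq_univ_of_forall fun x => ?_
    by_cases hx : x ∈ N.φ '' Annulus.interior
    · exact Or.inl (image_subset_range _ _ hx)
    · exact Or.inr hx
  rw [← continuousOn_univ, ← hu]
  refine ContinuousOn.union_of_isClosed ?_ ?_ h1 h2
  · rw [continuousOn_iff_continuous_domRestrict]
    have : (range N.φ).domRestrict (Function.extend N.φ (N.φ ∘ e) id) =
        N.φ ∘ e ∘ N.isEmbedding.toHomeomorph.symm := by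
      funext x
      obtain ⟨_, a, rfl⟩ := x
      have : N.isEmbedding.toHomeomorph.symm ⟨N.φ a, a, rfl⟩ = a :=
        N.isEmbedding.toHomeomorph.symm_apply_apply a
      simp only [Function.comp_apply, this]
      exact N.extend_apply e a
    rw [this]
    exact N.isEmbedding.continuous.comp (e.continuous.comp (Homeomorph.continuous _))
  · exact continuousOn_id.congr fun x hx => N.extend_apply_of_not_mem e he hx

theorem extend_symm_extend (e : Annulus ≃ₜ Annulus) (x : S) :
    Function.extend N.φ (N.φ ∘ e.symm) id (Function.extend N.φ (N.φ ∘ e) id x) = x := by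
  by_cases h : ∃ a, N.φ a = x
  · obtain ⟨a, rfl⟩ := h
    rw [N.extend_apply, N.extend_apply, e.symm_apply_apply]
  · rw [Function.extend_apply' (N.φ ∘ e) _ _ h, id, Function.extend_apply' _ _ _ h, id]

/-- The Dehn twist with support in an annular neighbourhood `N`: it is `φ ∘ T ∘ φ⁻¹` on `N`, with
`T` the twist map of the annulus, and the identity outside `N`. -/
noncomputable def dehnTwist [T2Space S] : S ≃ₜ S where
  toFun := Function.extend N.φ (N.φ ∘ Annulus.twist) id
  invFun := Function.extend N.φ (N.φ ∘ Annulus.twist.symm) id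
  left_inv := N.extend_symm_extend Annulus.twist
  right_inv := N.extend_symm_extend Annulus.twist.symm
  continuous_toFun := N.continuous_extend _ fun _ ha => Annulus.twist_of_not_mem_interior ha
  continuous_invFun := N.continuous_extend _ fun a ha => by
    rw [Homeomorph.symm_apply_eq, Annulus.twist_of_not_mem_interior ha]

end AnnularNbhd

/-- `τ` is a Dehn twist about `c`: it is isotopic to the twist supported in an annular
neighbourhood of `c`. Both handednesses are covered, since the parametrization of the annular
neighbourhood may preserve or reverse a given orientation of the surface. -/
def IsDehnTwist {S : Type*} [TopologicalSpace S] [T2Space S] (c : Set S) (τ : S ≃ₜ S) : Prop :=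
  ∃ N : AnnularNbhd c, IsotopicHomeo N.dehnTwist τ

/-! ### The handlebody determined by a full set of curves, and its disk set -/

/-- Pairwise disjoint annular neighbourhoods of the curves of a finite family `Z`, along which
2-handles are attached. -/
structure HandleData {S : Type*} [TopologicalSpace S] {n : ℕ} (Z : Fin n → Set S) where
  nbhd : ∀ i, AnnularNbhd (Z i)
  disjoint : Pairwise fun i j => Disjoint (range (nbhd i).φ) (range (nbhd j).φ)

namespace HandleData

variable {S : Type*} [TopologicalSpace S] {n : ℕ} {Z : Fin n → Set S} (D : HandleData Z)

/-- The gluing of the 2-handles `D² × [0, 1]` to `S × [0, 1]`: the attaching region `S¹ × [0, 1]`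
of the `i`-th handle is glued to the `i`-th annulus in `S × {1}`. -/
inductive Rel : (S × unitInterval) ⊕ (Fin n × UnitDisk × unitInterval) →
    (S × unitInterval) ⊕ (Fin n × UnitDisk × unitInterval) → Prop
  | glue (i : Fin n) (z : Circle) (t : unitInterval) :
      Rel (Sum.inr (i, UnitDisk.ofCircle z, t)) (Sum.inl ((D.nbhd i).φ (z, t), 1))

/-- The 3-manifold obtained from `S × [0, 1]` by attaching a 2-handle to `S × {1}` along each of
the curves. -/
def Space : Type _ := Quot D.Rel

instance : TopologicalSpace D.Space := inferInstanceAs (TopologicalSpace (Quot D.Rel))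

/-- The part of the boundary of `D.Space` other than `S × {0}`: what is left of `S × {1}`, together
with the two parallel copies of the core disk on each handle. -/
def outerBoundary : Set D.Space :=
  {y | (∃ x : S, (∀ i, x ∉ (D.nbhd i).φ '' Annulus.interior) ∧
      y = Quot.mk D.Rel (Sum.inl (x, 1))) ∨
    ∃ (i : Fin n) (z : UnitDisk) (t : unitInterval), (t = 0 ∨ t = 1) ∧
      y = Quot.mk D.Rel (Sum.inr (i, z, t))}

end HandleData

/-- The choices in the construction of the handlebody `V_Z`: the 2-handles, and parametrizations
of the spheres which make up the outer boundary, to each of which a 3-ball is attached. -/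
structure HandlebodyData {S : Type*} [TopologicalSpace S] {n : ℕ} (Z : Fin n → Set S) where
  handles : HandleData Z
  numBalls : ℕ
  sphere : Fin numBalls → UnitSphere → handles.Space
  sphere_isEmbedding : ∀ j, IsEmbedding (sphere j)
  sphere_disjoint : Pairwise fun j l => Disjoint (range (sphere j)) (range (sphere l))
  sphere_union : ⋃ j, range (sphere j) = handles.outerBoundary

namespace HandlebodyData

variable {S : Type*} [TopologicalSpace S] {n : ℕ} {Z : Fin n → Set S} (D : HandlebodyData Z)

/-- The gluing of a 3-ball to each of the boundary spheres. -/
inductive Rel : D.handles.Space ⊕ (Fin D.numBalls × UnitBall) →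
    D.handles.Space ⊕ (Fin D.numBalls × UnitBall) → Prop
  | glue (j : Fin D.numBalls) (x : UnitSphere) :
      Rel (Sum.inr (j, UnitBall.ofSphere x)) (Sum.inl (D.sphere j x))

/-- The handlebody `V_Z`: 2-handles are attached to `S × [0, 1]` along the curves of `Z` in
`S × {1}`, and the resulting boundary spheres are capped off by 3-balls. -/
def Handlebody : Type _ := Quot D.Rel

instance : TopologicalSpace D.Handlebody := inferInstanceAs (TopologicalSpace (Quot D.Rel))

/-- The identification of `S` with the boundary `S × {0}` of the handlebody. -/
def boundary (x : S) : D.Handlebody :=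
  Quot.mk D.Rel (Sum.inl (Quot.mk D.handles.Rel (Sum.inl (x, 0))))

/-- The curve `c` in `S = ∂V_Z` bounds a properly embedded disk in the handlebody. -/
def BoundsDisk (c : Set S) : Prop :=
  ∃ f : UnitDisk → D.Handlebody, IsEmbedding f ∧ f '' UnitDisk.circle = D.boundary '' c ∧
    f ⁻¹' range D.boundary = UnitDisk.circle

end HandlebodyData

/-- The disk set `K_Z` of `V_Z`: the isotopy classes of essential simple closed curves in `S` that
bound embedded disks in `V_Z`. (Different choices in the construction of `V_Z` give handlebodies
that are homeomorphic by a homeomorphism fixing the boundary, so the choice does not matter.) -/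
def diskSet {S : Type*} [TopologicalSpace S] {n : ℕ} (Z : Fin n → Set S) : Set (CurveVertex S) :=
  {v | ∃ c : EssentialCurve S, c.toVertex = v ∧ ∃ D : HandlebodyData Z, D.BoundsDisk c.1}

/-! ### Transport of handlebodies along homeomorphisms -/

/-! The bound comes from doubling a path. Take a path of length d from a disk vertex u to [γ] and
let w be its last vertex before [γ]. Since w has a representative disjoint from γ itself
(`exists_toVertex_eq_disjoint`), every power of τ fixes w. Dropping the last edge leaves a path of
length d - 1 from u to w; its image under τ^k joins τ^k u to the same w. Glued at w, the two have
total length 2d - 2.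

Two facts carry this. First, τ^k u lies in the disk set of τ^k(P) (`smul_mem_diskSet`): a
homeomorphism of the surface carries all gluing data along, hence induces a homeomorphism of
handlebodies compatible with the boundary. Second, a twist about γ fixes the class of each curve
disjoint from γ (`IsDehnTwist.smul_toVertex_eq`): such a curve is compact, so it stays away from a
strip about γ, and the twisting can be isotoped into that strip. -/

/-- The image of an annular neighbourhood under a homeomorphism. -/
def AnnularNbhd.map {S : Type*} [TopologicalSpace S] {c : Set S} (N : AnnularNbhd c)
    (h : S ≃ₜ S) : AnnularNbhd (h '' c) where
  φ := h ∘ N.φ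
  isEmbedding := h.isEmbedding.comp N.isEmbedding
  isOpen_interior := by
    rw [image_comp]
    exact h.isOpenMap _ N.isOpen_interior
  core := by rw [image_comp, N.core]

namespace HandleData

variable {S : Type*} [TopologicalSpace S] {n : ℕ} {Z : Fin n → Set S} (D : HandleData Z)

/-- The image of a system of attaching annuli under a homeomorphism. -/
def map (h : S ≃ₜ S) : HandleData (fun i => h '' Z i) where
  nbhd i := (D.nbhd i).map h
  disjoint i j hij := by
    change Disjoint (range (h ∘ (D.nbhd i).φ)) (range (h ∘ (D.nbhd j).φ))
    rw [range_comp, range_comp, disjoint_image_iff h.injective]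
    exact D.disjoint hij

/-- The homeomorphism between the unglued pieces induced by a homeomorphism of the surface. -/
noncomputable def piecesHomeomorph (n : ℕ) (h : S ≃ₜ S) :
    (S × unitInterval) ⊕ (Fin n × UnitDisk × unitInterval) ≃ₜ
      (S × unitInterval) ⊕ (Fin n × UnitDisk × unitInterval) :=
  (h.prodCongr (Homeomorph.refl _)).sumCongr (Homeomorph.refl _)

/-- The attaching maps of `D.map h` are those of `D` followed by `h`, so glued pairs correspond.
Both directions are needed for the quotients to be homeomorphic. -/
theorem rel_map_iff (h : S ≃ₜ S) (a b : (S × unitInterval) ⊕ (Fin n × UnitDisk × unitInterval)) :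
    D.Rel a b ↔ (D.map h).Rel (piecesHomeomorph n h a) (piecesHomeomorph n h b) := by
  constructor
  · rintro ⟨i, z, t⟩
    exact Rel.glue (D := D.map h) i z t
  · intro hr
    -- Case analysis on the gluing relation needs variables as its endpoints; injectivity then
    -- recovers `a` and `b`.
    generalize ha : piecesHomeomorph n h a = a' at hr
    generalize hb : piecesHomeomorph n h b = b' at hr
    obtain ⟨i, z, t⟩ := hr
    have ha' : a = Sum.inr (i, UnitDisk.ofCircle z, t) :=
      (piecesHomeomorph n h).injective ha
    have hb' : b = Sum.inl ((D.nbhd i).φ (z, t), 1) :=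
      (piecesHomeomorph n h).injective hb
    rw [ha', hb']
    exact Rel.glue i z t

/-- The homeomorphism of the manifolds with 2-handles induced by a homeomorphism of the surface. -/
noncomputable def spaceHomeomorph (h : S ≃ₜ S) : D.Space ≃ₜ (D.map h).Space :=
  Homeomorph.Quot.congr (piecesHomeomorph n h) (D.rel_map_iff h)

/-- Needed for the transported spheres to fill exactly the new outer boundary, so that the same
balls can be attached. -/
theorem image_outerBoundary (h : S ≃ₜ S) :
    D.spaceHomeomorph h '' D.outerBoundary = (D.map h).outerBoundary := by
  have hint (i : Fin n) (x : S) : h x ∈ ((D.map h).nbhd i).φ '' Annulus.interior ↔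
      x ∈ (D.nbhd i).φ '' Annulus.interior := by
    change h x ∈ (h ∘ (D.nbhd i).φ) '' Annulus.interior ↔ _
    rw [image_comp, h.injective.mem_set_image]
  apply Subset.antisymm
  · rintro _ ⟨_, ⟨x, hx, rfl⟩ | ⟨i, z, t, ht, rfl⟩, rfl⟩
    · exact Or.inl ⟨h x, fun i => (hint i x).not.2 (hx i), rfl⟩
    · exact Or.inr ⟨i, z, t, ht, rfl⟩
  · rintro _ (⟨y, hy, rfl⟩ | ⟨i, z, t, ht, rfl⟩)
    · obtain ⟨x, rfl⟩ := h.surjective y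
      exact ⟨_, Or.inl ⟨x, fun i => (hint i x).not.1 (hy i), rfl⟩, rfl⟩
    · exact ⟨_, Or.inr ⟨i, z, t, ht, rfl⟩, rfl⟩

end HandleData

namespace HandlebodyData

variable {S : Type*} [TopologicalSpace S] {n : ℕ} {Z : Fin n → Set S} (D : HandlebodyData Z)

/-- The image of the handlebody data under a homeomorphism of the surface. -/
noncomputable def map (h : S ≃ₜ S) : HandlebodyData (fun i => h '' Z i) where
  handles := D.handles.map h
  numBalls := D.numBalls
  sphere j := D.handles.spaceHomeomorph h ∘ D.sphere j
  sphere_isEmbedding j := (D.handles.spaceHomeomorph h).isEmbedding.comp (D.sphere_isEmbedding j)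
  sphere_disjoint i j hij := by
    dsimp only
    rw [range_comp, range_comp, disjoint_image_iff (D.handles.spaceHomeomorph h).injective]
    exact D.sphere_disjoint hij
  sphere_union := by
    simp_rw [range_comp]
    rw [← image_iUnion, D.sphere_union, D.handles.image_outerBoundary]

/-- The homeomorphism of unglued pieces induced by a homeomorphism of the surface. -/
noncomputable def piecesHomeomorph (h : S ≃ₜ S) :
    D.handles.Space ⊕ (Fin D.numBalls × UnitBall) ≃ₜ
      (D.map h).handles.Space ⊕ (Fin (D.map h).numBalls × UnitBall) :=
  (D.handles.spaceHomeomorph h).sumCongr (Homeomorph.refl (Fin D.numBalls × UnitBall))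

theorem rel_map_iff (h : S ≃ₜ S) (a b : D.handles.Space ⊕ (Fin D.numBalls × UnitBall)) :
    D.Rel a b ↔ (D.map h).Rel (D.piecesHomeomorph h a) (D.piecesHomeomorph h b) := by
  constructor
  · rintro ⟨j, x⟩
    exact Rel.glue (D := D.map h) j x
  · intro hr
    generalize ha : D.piecesHomeomorph h a = a' at hr
    generalize hb : D.piecesHomeomorph h b = b' at hr
    obtain ⟨j, x⟩ := hr
    have ha' : a = Sum.inr (j, UnitBall.ofSphere x) := (D.piecesHomeomorph h).injective ha
    have hb' : b = Sum.inl (D.sphere j x) := (D.piecesHomeomorph h).injective hb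
    rw [ha', hb']
    exact Rel.glue (D := D) j x

/-- The homeomorphism of handlebodies induced by a homeomorphism of the surface. -/
noncomputable def handlebodyHomeomorph (h : S ≃ₜ S) : D.Handlebody ≃ₜ (D.map h).Handlebody :=
  Homeomorph.Quot.congr (D.piecesHomeomorph h) (D.rel_map_iff h)

theorem BoundsDisk.map {D : HandlebodyData Z} {c : Set S} (hc : D.BoundsDisk c) (h : S ≃ₜ S) :
    (D.map h).BoundsDisk (h '' c) := by
  obtain ⟨f, hf, hfc, hfb⟩ := hc
  -- The handlebody homeomorphism extends `h` on the boundary surface.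
  have hcomp : (D.map h).boundary ∘ h = D.handlebodyHomeomorph h ∘ D.boundary := rfl
  refine ⟨D.handlebodyHomeomorph h ∘ f, (D.handlebodyHomeomorph h).isEmbedding.comp hf, ?_, ?_⟩
  · rw [image_comp, hfc, ← image_comp, ← image_comp, hcomp]
  · rw [← h.surjective.range_comp, hcomp, range_comp, preimage_comp,
      preimage_image_eq _ (D.handlebodyHomeomorph h).injective, hfb]

end HandlebodyData

/-! ### The action of homeomorphisms on the curve complex -/

section Action

variable {S : Type*} [TopologicalSpace S]

theorem IsEssentialCurve.image {c : Set S} (hc : IsEssentialCurve c) (h : S ≃ₜ S) :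
    IsEssentialCurve (h '' c) := by
  obtain ⟨f, hf, rfl, hn⟩ := hc
  refine ⟨(h : C(S, S)).comp f, h.isEmbedding.comp hf, (range_comp h f :), fun hh => hn ?_⟩
  have := hh.comp_right (h.symm : C(S, S))
  rwa [← ContinuousMap.comp_assoc, show (h.symm : C(S, S)).comp (h : C(S, S)) =
    ContinuousMap.id S from ContinuousMap.ext h.symm_apply_apply, ContinuousMap.id_comp] at this

/-- If `H` is the isotopy, then `H t ∘ (H 0)⁻¹` starts at the identity and ends at a map taking the
first image to the second. -/
theorem IsotopicHomeo.isotopicSets_image {f g : S ≃ₜ S} (h : IsotopicHomeo f g) (c : Set S) :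
    IsotopicSets (f '' c) (g '' c) := by
  obtain ⟨H, hc, rfl, rfl⟩ := h
  refine ⟨(H 0).symm.trans (H 1), ⟨fun t => (H 0).symm.trans (H t), ?_, ?_, rfl⟩, ?_⟩
  · exact hc.comp (f := fun p : unitInterval × S => (p.1, (H 0).symm p.2)) (by fun_prop)
  · ext x; simp
  · rw [← image_comp]; congr 1; ext x; simp

theorem IsotopicSets.image {c c' : Set S} (h : IsotopicSets c c') (e : S ≃ₜ S) :
    IsotopicSets (e '' c) (e '' c') := by
  obtain ⟨f, ⟨H, hc, h0, rfl⟩, rfl⟩ := h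
  have hH : IsotopicHomeo e ((H 1).trans e) :=
    ⟨fun t => (H t).trans e, e.continuous.comp hc, by ext x; simp [h0], rfl⟩
  have := hH.isotopicSets_image c
  rwa [show ((H 1).trans e : S → S) = e ∘ H 1 from rfl, image_comp] at this

/-- The image of an essential curve under a homeomorphism. -/
def EssentialCurve.map (c : EssentialCurve S) (h : S ≃ₜ S) : EssentialCurve S :=
  ⟨h '' c.1, c.2.image h⟩

instance : MulAction (S ≃ₜ S) (CurveVertex S) where
  smul h := Quotient.map (fun c => c.map h) fun _ _ hc => IsotopicSets.image hc h
  one_smul v := by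
    induction v using Quotient.inductionOn with
    | h c => exact congrArg (Quotient.mk _) (Subtype.ext (image_id c.1))
  mul_smul f g v := by
    induction v using Quotient.inductionOn with
    | h c => exact congrArg (Quotient.mk _) (Subtype.ext (image_comp f g c.1))

theorem EssentialCurve.smul_toVertex (h : S ≃ₜ S) (c : EssentialCurve S) :
    h • c.toVertex = (c.map h).toVertex := rfl

theorem curveGraph_adj_smul (h : S ≃ₜ S) {v w : CurveVertex S} (hvw : (curveGraph S).Adj v w) :
    (curveGraph S).Adj (h • v) (h • w) := by
  obtain ⟨hne, a, b, rfl, rfl, hd⟩ := hvw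
  exact ⟨(MulAction.injective h).ne hne, a.map h, b.map h, rfl, rfl,
    (disjoint_image_iff h.injective).2 hd⟩

theorem smul_mem_diskSet {n : ℕ} {Z : Fin n → Set S} (h : S ≃ₜ S) {v : CurveVertex S}
    (hv : v ∈ diskSet Z) : h • v ∈ diskSet (fun i => h '' Z i) := by
  obtain ⟨c, rfl, D, hD⟩ := hv
  exact ⟨c.map h, rfl, D.map h, hD.map h⟩

/-- A vertex adjacent to `[c]` has a representative disjoint from `c` itself. -/
theorem exists_toVertex_eq_disjoint {v : CurveVertex S} {c : EssentialCurve S}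
    (h : (curveGraph S).Adj v c.toVertex) :
    ∃ a : EssentialCurve S, a.toVertex = v ∧ Disjoint a.1 c.1 := by
  obtain ⟨-, a, b, rfl, hb, hd⟩ := h
  obtain ⟨f, hf, hfb⟩ : IsotopicSets b.1 c.1 := Quotient.exact hb
  refine ⟨a.map f, Quotient.sound (IsotopicSets.symm ⟨f, hf, rfl⟩), ?_⟩
  rw [← hfb]
  exact (disjoint_image_iff f.injective).2 hd

theorem exists_walk_of_curveDist_eq {A B : Set (CurveVertex S)} {d : ℕ}
    (h : curveDist A B = (d : ℕ∞)) :
    ∃ u ∈ A, ∃ v ∈ B, ∃ p : (curveGraph S).Walk u v, p.length = d := by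
  -- A strict bound on an infimum yields actual vertices; over the integers, `< d + 1` loses
  -- nothing.
  have hlt : curveDist A B < ((d + 1 : ℕ) : ℕ∞) := by
    rw [h]; exact_mod_cast Nat.lt_succ_self d
  simp only [curveDist, iInf_lt_iff] at hlt
  obtain ⟨u, hu, v, hv, huv⟩ := hlt
  obtain ⟨p, hp⟩ := SimpleGraph.exists_walk_of_edist_ne_top (huv.trans_le le_top).ne
  refine ⟨u, hu, v, hv, p, le_antisymm ?_ ?_⟩
  · rw [← hp] at huv
    exact Nat.lt_succ_iff.1 (by exact_mod_cast huv)
  · have : curveDist A B ≤ (curveGraph S).edist u v := iInf₂_le_of_le u hu (iInf₂_le v hv)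
    rw [h, ← hp] at this
    exact_mod_cast this

end Action

/-! ### Dehn twists fix the curves disjoint from the core -/

/-- The shear `(θ, t) ↦ (θ + 2π u(t), t)` of the annulus. -/
noncomputable def Annulus.shear (u : C(unitInterval, ℝ)) : Annulus ≃ₜ Annulus where
  toFun a := (a.1 * Circle.exp (2 * Real.pi * u a.2), a.2)
  invFun a := (a.1 * (Circle.exp (2 * Real.pi * u a.2))⁻¹, a.2)
  left_inv a := by simp
  right_inv a := by simp
  continuous_toFun := by fun_prop
  continuous_invFun := by fun_prop

theorem Annulus.shear_eq_self_of_eq_zero_or_one {u : C(unitInterval, ℝ)} {a : Annulus}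
    (h : u a.2 = 0 ∨ u a.2 = 1) : Annulus.shear u a = a := by
  rcases h with h | h <;> simp [Annulus.shear, h]

theorem Annulus.eq_zero_or_one_of_not_mem_interior {a : Annulus} (ha : a ∉ Annulus.interior) :
    a.2 = 0 ∨ a.2 = 1 := by
  by_contra! h
  exact ha ⟨lt_of_le_of_ne a.2.2.1 fun e => h.1 e.symm,
    lt_of_le_of_ne a.2.2.2 fun e => h.2 e⟩

/-- The ramp that rises from `0` to `1` on the interval of radius `ε` about `1/2`. -/
noncomputable def ramp (ε : ℝ) : C(unitInterval, ℝ) where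
  toFun t := max 0 (min 1 (((t : ℝ) - 1 / 2 + ε) / (2 * ε)))
  continuous_toFun := by fun_prop

theorem ramp_of_le {ε : ℝ} (hε : 0 < ε) {t : unitInterval} (h : (t : ℝ) ≤ 1 / 2 - ε) :
    ramp ε t = 0 := by
  have : ((t : ℝ) - 1 / 2 + ε) / (2 * ε) ≤ 0 :=
    div_nonpos_of_nonpos_of_nonneg (by linarith) (by linarith)
  exact max_eq_left ((min_le_right _ _).trans this)

theorem ramp_of_ge {ε : ℝ} (hε : 0 < ε) {t : unitInterval} (h : 1 / 2 + ε ≤ (t : ℝ)) :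
    ramp ε t = 1 := by
  have : 1 ≤ ((t : ℝ) - 1 / 2 + ε) / (2 * ε) := by
    rw [le_div_iff₀ (by linarith)]; linarith
  change max 0 (min 1 (((t : ℝ) - 1 / 2 + ε) / (2 * ε))) = 1
  rw [min_eq_left this, max_eq_right zero_le_one]

namespace AnnularNbhd

variable {S : Type*} [TopologicalSpace S] [T2Space S] {c : Set S} (N : AnnularNbhd c)

/-- The homeomorphism that acts by a shear on the annulus and by the identity elsewhere. -/
noncomputable def shear (u : C(unitInterval, ℝ)) (h0 : u 0 = 0) (h1 : u 1 = 1) : S ≃ₜ S :=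
  have hu : ∀ a, a ∉ Annulus.interior → Annulus.shear u a = a := fun a ha =>
    Annulus.shear_eq_self_of_eq_zero_or_one <|
      (Annulus.eq_zero_or_one_of_not_mem_interior ha).imp (fun h => by rw [h, h0])
        fun h => by rw [h, h1]
  { toFun := Function.extend N.φ (N.φ ∘ Annulus.shear u) id
    invFun := Function.extend N.φ (N.φ ∘ (Annulus.shear u).symm) id
    left_inv := N.extend_symm_extend (Annulus.shear u)
    right_inv := N.extend_symm_extend (Annulus.shear u).symm
    continuous_toFun := N.continuous_extend _ hu
    continuous_invFun := N.continuous_extend _ fun a ha => by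
      rw [Homeomorph.symm_apply_eq, hu a ha] }

theorem shear_apply (u : C(unitInterval, ℝ)) (h0 : u 0 = 0) (h1 : u 1 = 1) (a : Annulus) :
    N.shear u h0 h1 (N.φ a) = N.φ (Annulus.shear u a) :=
  N.extend_apply _ a

theorem shear_congr {u v : C(unitInterval, ℝ)} (h : u = v) (h0 : u 0 = 0) (h1 : u 1 = 1)
    (h0' : v 0 = 0) (h1' : v 1 = 1) : N.shear u h0 h1 = N.shear v h0' h1' := by
  subst h; rfl

theorem shear_apply_of_not_mem_range (u : C(unitInterval, ℝ)) (h0 : u 0 = 0) (h1 : u 1 = 1)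
    {x : S} (hx : x ∉ range N.φ) : N.shear u h0 h1 x = x :=
  Function.extend_apply' _ _ _ hx

theorem shear_apply_of_not_mem_interior (u : C(unitInterval, ℝ)) (h0 : u 0 = 0) (h1 : u 1 = 1)
    {x : S} (hx : x ∉ N.φ '' Annulus.interior) : N.shear u h0 h1 x = x := by
  by_cases h : x ∈ range N.φ
  · obtain ⟨a, rfl⟩ := h
    have ha : a ∉ Annulus.interior := fun ha => hx ⟨a, ha, rfl⟩
    rw [N.shear_apply, Annulus.shear_eq_self_of_eq_zero_or_one]
    exact (Annulus.eq_zero_or_one_of_not_mem_interior ha).imp (fun h => by rw [h, h0])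
      fun h => by rw [h, h1]
  · exact N.shear_apply_of_not_mem_range u h0 h1 h

/-- A continuous family of shears is an isotopy. -/
theorem continuous_shear (u : unitInterval → C(unitInterval, ℝ))
    (hu : Continuous fun p : unitInterval × unitInterval => u p.1 p.2)
    (h0 : ∀ s, u s 0 = 0) (h1 : ∀ s, u s 1 = 1) :
    Continuous fun p : unitInterval × S => N.shear (u p.1) (h0 p.1) (h1 p.1) p.2 := by
  have hR : IsClosed (range N.φ) := (isCompact_range N.isEmbedding.continuous).isClosed
  have hU : (univ ×ˢ range N.φ) ∪ (univ ×ˢ (N.φ '' Annulus.interior)ᶜ) =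
      (univ : Set (unitInterval × S)) := by
    refine eq_univ_of_forall fun x => ?_
    by_cases hx : x.2 ∈ N.φ '' Annulus.interior
    · exact Or.inl ⟨trivial, image_subset_range _ _ hx⟩
    · exact Or.inr ⟨trivial, hx⟩
  rw [← continuousOn_univ, ← hU]
  refine ContinuousOn.union_of_isClosed ?_ ?_ (isClosed_univ.prod hR)
    (isClosed_univ.prod N.isOpen_interior.isClosed_compl)
  · let E : unitInterval × Annulus → unitInterval × S := Prod.map id N.φ
    have hE : IsEmbedding E := IsEmbedding.id.prodMap N.isEmbedding
    have hr : univ ×ˢ range N.φ = range E := by rw [range_prodMap, range_id]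
    have hcomp : (fun p : unitInterval × S => N.shear (u p.1) (h0 p.1) (h1 p.1) p.2) ∘ E =
        fun q => N.φ (Annulus.shear (u q.1) q.2) :=
      funext fun q => N.shear_apply _ _ _ _
    have hc : Continuous fun q : unitInterval × Annulus => N.φ (Annulus.shear (u q.1) q.2) := by
      have hu' : Continuous fun q : unitInterval × Annulus => u q.1 q.2.2 :=
        hu.comp (f := fun q : unitInterval × Annulus => (q.1, q.2.2)) (by fun_prop)
      refine N.isEmbedding.continuous.comp (Continuous.prodMk ?_ (by fun_prop))
      fun_prop
    rw [hr, continuousOn_iff_continuous_domRestrict,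
      -- Continuity on the closed annulus is tested after pulling back along `E`, where the map is
      -- an explicit shear.
      ← hE.toHomeomorph.comp_continuous_iff']
    exact hcomp ▸ hc
  · exact continuousOn_snd.congr fun p hp => N.shear_apply_of_not_mem_interior _ _ _ hp.2

/-- The shears of an annular neighbourhood are isotopic to its Dehn twist. -/
theorem isotopicHomeo_shear (u : C(unitInterval, ℝ)) (h0 : u 0 = 0) (h1 : u 1 = 1) :
    IsotopicHomeo N.dehnTwist (N.shear u h0 h1) := by
  -- Straight-line homotopy from the profile `t ↦ t` of the twist to `u`. The end values stay 0 and
  -- 1, so each stage extends by the identity.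
  let w (s : unitInterval) : C(unitInterval, ℝ) :=
    ⟨fun t => (1 - (s : ℝ)) * t + s * u t, by fun_prop⟩
  have hw0 (s : unitInterval) : w s 0 = 0 := by simp [w, h0]
  have hw1 (s : unitInterval) : w s 1 = 1 := by simp [w, h1]
  refine ⟨fun s => N.shear (w s) (hw0 s) (hw1 s), N.continuous_shear w ?_ hw0 hw1, ?_, ?_⟩
  · change Continuous fun p : unitInterval × unitInterval =>
      (1 - (p.1 : ℝ)) * p.2 + p.1 * u p.2
    fun_prop
  · have : Annulus.shear (w 0) = Annulus.twist := by
      ext a <;> simp [w, Annulus.shear, Annulus.twist]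
    ext x
    change Function.extend N.φ (N.φ ∘ Annulus.shear (w 0)) id x = _
    rw [this]; rfl
  · exact N.shear_congr (by ext t; simp [w]) _ _ _ _

/-- A compact set disjoint from the core misses a whole subannulus about the core. -/
theorem exists_pos_forall_le_abs {K : Set S} (hK : IsCompact K) (hd : Disjoint K c) :
    ∃ ε : ℝ, 0 < ε ∧ ε ≤ 1 / 2 ∧ ∀ a : Annulus, N.φ a ∈ K → ε ≤ |(a.2 : ℝ) - 1 / 2| := by
  have hL : IsCompact (N.φ ⁻¹' K) := (hK.isClosed.preimage N.isEmbedding.continuous).isCompact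
  obtain he | hne := (N.φ ⁻¹' K).eq_empty_or_nonempty
  -- If `K` misses the annulus any ε works; the cap 1/2 keeps the ramp's strip inside the annulus.
  · refine ⟨1 / 2, by norm_num, le_rfl, fun a ha => ?_⟩
    exact absurd (show a ∈ N.φ ⁻¹' K from ha) (by simp [he])
  · obtain ⟨b, hb, hmin⟩ := hL.exists_isMinOn hne
      (f := fun a : Annulus => |(a.2 : ℝ) - 1 / 2|) (by fun_prop)
    refine ⟨|(b.2 : ℝ) - 1 / 2|, abs_pos.2 fun h => ?_, ?_, fun a ha => hmin ha⟩
    · have hc : N.φ b ∈ N.φ '' Annulus.core := mem_image_of_mem _ (sub_eq_zero.1 h)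
      rw [N.core] at hc
      exact disjoint_left.1 hd hb hc
    · have h0 := b.2.2.1
      have h1 := b.2.2.2
      rw [abs_le]; constructor <;> linarith

/-- A Dehn twist preserves, up to isotopy, each compact set disjoint from its core. -/
theorem isotopicSets_dehnTwist_image {K : Set S} (hK : IsCompact K) (hd : Disjoint K c) :
    IsotopicSets (N.dehnTwist '' K) K := by
  obtain ⟨ε, hε, hε', h⟩ := N.exists_pos_forall_le_abs hK hd
  have h0 : ramp ε 0 = 0 := ramp_of_le hε (by simpa using hε')
  have h1 : ramp ε 1 = 1 := ramp_of_ge hε (by simp only [Icc.coe_one]; linarith)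
  -- Outside the ε-strip the ramp is 0 or 1, so the shear rotates by no turn or one full turn.
  have hfix : ∀ x ∈ K, N.shear (ramp ε) h0 h1 x = x := by
    intro x hx
    by_cases hr : x ∈ range N.φ
    · obtain ⟨a, rfl⟩ := hr
      rw [N.shear_apply, Annulus.shear_eq_self_of_eq_zero_or_one]
      rcases le_abs'.1 (h a hx) with h | h
      · exact Or.inl (ramp_of_le hε (by linarith))
      · exact Or.inr (ramp_of_ge hε (by linarith))
    · exact N.shear_apply_of_not_mem_range _ _ _ hr
  have := (N.isotopicHomeo_shear (ramp ε) h0 h1).isotopicSets_image K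
  rwa [show N.shear (ramp ε) h0 h1 '' K = K by
    rw [image_congr hfix, image_id']] at this

end AnnularNbhd

/-- A Dehn twist about `c` fixes the isotopy class of each curve disjoint from `c`. -/
theorem IsDehnTwist.smul_toVertex_eq {S : Type*} [TopologicalSpace S] [T2Space S] {c : Set S}
    {τ : S ≃ₜ S} (hτ : IsDehnTwist c τ) {a : EssentialCurve S} (hd : Disjoint a.1 c) :
    τ • a.toVertex = a.toVertex := by
  obtain ⟨N, hN⟩ := hτ
  obtain ⟨f, -, hf, -⟩ := a.2
  have hK : IsCompact a.1 := hf ▸ isCompact_range f.continuous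
  exact Quotient.sound
    ((hN.isotopicSets_image a.1).symm.trans (N.isotopicSets_dehnTwist_image hK hd))

theorem mainTheorem8 {S : Type*} [TopologicalSpace S] [T2Space S] [CompactSpace S]
    [ConnectedSpace S] [ChartedSpace (EuclideanSpace ℝ (Fin 2)) S]
    (hS : IsOrientableSurface S) (g : ℕ) (hg : 2 ≤ g) (hgenus : HasGenus S g)
    (P : Fin (3 * g - 3) → Set S) (hP : IsPantsDecomposition g P)
    (γ : EssentialCurve S) (τ : S ≃ₜ S) (hτ : IsDehnTwist γ.1 τ)
    (d : ℕ) (hd : 1 ≤ d) (hdist : curveDist (diskSet P) {γ.toVertex} = (d : ℕ∞)) (k : ℤ) :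
    curveDist (diskSet P) (diskSet (fun i => (τ ^ k) '' P i)) ≤ ((2 * d - 2 : ℕ) : ℕ∞) := by
  obtain ⟨u, hu, _, rfl, p, hp⟩ := exists_walk_of_curveDist_eq hdist
  -- Here `1 ≤ d` enters: only a path with an edge has a vertex adjacent to [γ] just before its end.
  have hnil : ¬ p.Nil := fun h => by
    have := SimpleGraph.Walk.length_eq_zero_iff.2 h
    omega
  obtain ⟨a, ha, had⟩ := exists_toVertex_eq_disjoint (p.adj_penultimate hnil)
  have hfix : (τ ^ k) • p.penultimate = p.penultimate := by
    -- The stabilizer is a subgroup, so negative powers are covered too.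
    have : τ ∈ MulAction.stabilizer (S ≃ₜ S) p.penultimate := by
      rw [MulAction.mem_stabilizer_iff, ← ha]
      exact hτ.smul_toVertex_eq had
    exact zpow_mem this k
  let q := p.dropLast
  have hq : q.length = d - 1 := by
    simp [q, hp]
  let F : curveGraph S →g curveGraph S := ⟨fun v => (τ ^ k) • v, curveGraph_adj_smul (τ ^ k)⟩
  -- The reversed image starts at the translate of w, which `hfix` identifies with w. For d = 1 both
  -- halves are trivial and u itself is fixed.
  let r := q.append ((q.map F).reverse.copy hfix rfl)
  have hr : r.length = 2 * d - 2 := by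
    simp only [r, SimpleGraph.Walk.length_append, SimpleGraph.Walk.length_copy,
      SimpleGraph.Walk.length_reverse, SimpleGraph.Walk.length_map, hq]
    omega
  calc curveDist (diskSet P) (diskSet fun i => (τ ^ k) '' P i)
      ≤ (curveGraph S).edist u ((τ ^ k) • u) :=
        iInf₂_le_of_le u hu (iInf₂_le _ (smul_mem_diskSet (τ ^ k) hu))
    _ ≤ r.length := r.edist_le
    _ = ((2 * d - 2 : ℕ) : ℕ∞) := by rw [hr]
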